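/- Let $d\in\mathbb N$, let $Q=[-1,1]^d\subset\mathbb R^d$, and let $\mathcal K$ be the collection of all non-empty compact subsets of $Q$, with the Hausdorff distance $d_H$ induced by the Euclidean norm. For $E\in\mathcal K$, $x\in E$ and $t>0$ put $$T_{x,t}(E)=\left\{\frac{y-x}{t}: y\in E\right\}\cap Q .$$ A set $F\in\mathcal K$ is called a *tangent set* of $E$ at $x$ if there is a sequence of positive numbers $t_n$ decreasing to $0$ such that $d_H(T_{x,t_n}(E),F)\to 0$ as $n\to\infty$. **Theorem.** For every real $s\in[0,d]$ there is a set $E\in\mathcal K$ of Hausdorff dimension $s$ such that $\{0\}$ is a tangent set of $E$ at every point $x\in E$. -/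

import Mathlib

open Filter Topology

/-- The cube `Q = [-1, 1]^d` in Euclidean space `ℝ^d`. -/
def cubeQ (d : ℕ) : Set (EuclideanSpace ℝ (Fin d)) :=
  {y | ∀ i, y i ∈ Set.Icc (-1 : ℝ) 1}

/-- The space of all non-empty compact subsets of `Q`. -/
def compactsQ (d : ℕ) : Set (Set (EuclideanSpace ℝ (Fin d))) :=
  {K | IsCompact K ∧ K.Nonempty ∧ K ⊆ cubeQ d}

/-- The zoom `T_{x,t}(E) = {(y - x) / t : y ∈ E} ∩ Q`. -/
def zoom {d : ℕ} (x : EuclideanSpace ℝ (Fin d)) (t : ℝ)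
    (E : Set (EuclideanSpace ℝ (Fin d))) : Set (EuclideanSpace ℝ (Fin d)) :=
  (fun y => t⁻¹ • (y - x)) '' E ∩ cubeQ d

/-- The collection `Tan(E, x)` of tangent sets of `E` at `x`: the non-empty compact subsets of `Q`
that are limits, in the Hausdorff distance, of zooms `T_{x,t_n}(E)` along some positive
sequence `t_n` decreasing to `0`. It is used for `E ∈ compactsQ d` and `x ∈ E`; the zooms are
then non-empty and compact, and the Hausdorff distance is finite. -/
def Tan {d : ℕ} (E : Set (EuclideanSpace ℝ (Fin d))) (x : EuclideanSpace ℝ (Fin d)) :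
    Set (Set (EuclideanSpace ℝ (Fin d))) :=
  {F | F ∈ compactsQ d ∧ ∃ t : ℕ → ℝ, (∀ n, 0 < t n) ∧ StrictAnti t ∧ Tendsto t atTop (𝓝 0) ∧
    Tendsto (fun n => Metric.hausdorffEDist (zoom x (t n) E) F) atTop (𝓝 0)}

open MeasureTheory Set

/-! For s > 0, take the d-th power of a Cantor set whose intervals of length B n are separated by
gaps of at least g n. Two points whose coordinates differ by less than g n have coordinates within B
(n+1) (`abs_sub_le_of_lt_gap`). At scale g n / 2 the zoom at every point thus has size O(B (n+1) / g
n), and {0} is tangent everywhere once this ratio tends to 0 along a subsequence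
(`singleton_zero_mem_Tan`).

The lengths are ρ ^ n with ρ = 2 ^ (-d/s), divided by a polynomially bounded factor that jumps from
N ^ 2 to N ^ 4 at the sparse indices N = 2 ^ 2 ^ k. The jumps drive the ratio to 0, while polynomial
factors do not affect the dimension: covering gives at most s (`dimH_pi_range_le`), and the Hölder
map reading binary digits gives at least s (`le_dimH_pi_range`). -/

/-- Basic interval lengths `B n` and lower bounds `g n` for the gaps of a homogeneous Cantor set
in which every interval of length `B n` has two children of length `B (n + 1)` at its ends. -/
structure IsCantorScale (B g : ℕ → ℝ) : Prop where
  gap_pos : ∀ n, 0 < g n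
  gap_anti : StrictAnti g
  gap_add_le : ∀ n, g n + 2 * B (n + 1) ≤ B n
  nonneg : ∀ n, 0 ≤ B n
  tendsto_zero : Tendsto B atTop (𝓝 0)

/-- The coding map of the homogeneous Cantor set with interval lengths `B n`. -/
noncomputable def cantorCode (B : ℕ → ℝ) (ω : ℕ → Fin 2) : ℝ :=
  ∑' n, (ω n : ℝ) * (B n - B (n + 1))

namespace IsCantorScale

variable {B g : ℕ → ℝ}

lemma shift (h : IsCantorScale B g) (n : ℕ) :
    IsCantorScale (fun i => B (i + n)) (fun i => g (i + n)) where
  gap_pos i := h.gap_pos _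
  gap_anti := h.gap_anti.comp_strictMono fun a b hab => by simpa using hab
  gap_add_le i := by
    have := h.gap_add_le (i + n)
    rwa [show i + n + 1 = i + 1 + n by ring] at this
  nonneg i := h.nonneg _
  tendsto_zero := (tendsto_add_atTop_iff_nat n).2 h.tendsto_zero

lemma sub_nonneg (h : IsCantorScale B g) (n : ℕ) : 0 ≤ B n - B (n + 1) := by
  linarith [h.gap_add_le n, h.nonneg (n + 1), h.gap_pos n]

lemma gap_le (h : IsCantorScale B g) (n : ℕ) : g n ≤ B n := by
  linarith [h.gap_add_le n, h.nonneg (n + 1)]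

lemma hasSum_sub (h : IsCantorScale B g) : HasSum (fun n => B n - B (n + 1)) (B 0) := by
  rw [hasSum_iff_tendsto_nat_of_nonneg h.sub_nonneg]
  simp_rw [Finset.sum_range_sub']
  simpa using h.tendsto_zero.const_sub (B 0)

lemma digit_mul_nonneg (h : IsCantorScale B g) (a : Fin 2) (n : ℕ) :
    0 ≤ (a : ℝ) * (B n - B (n + 1)) :=
  mul_nonneg (Nat.cast_nonneg _) (h.sub_nonneg n)

lemma digit_mul_le (h : IsCantorScale B g) (a : Fin 2) (n : ℕ) :
    (a : ℝ) * (B n - B (n + 1)) ≤ B n - B (n + 1) := by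
  refine mul_le_of_le_one_left (h.sub_nonneg n) ?_
  have : (a : ℕ) ≤ 1 := by omega
  exact_mod_cast this

lemma summable (h : IsCantorScale B g) (ω : ℕ → Fin 2) :
    Summable fun n => (ω n : ℝ) * (B n - B (n + 1)) :=
  h.hasSum_sub.summable.of_nonneg_of_le (fun n => h.digit_mul_nonneg _ n)
    (fun n => h.digit_mul_le _ n)

lemma cantorCode_nonneg (h : IsCantorScale B g) (ω : ℕ → Fin 2) : 0 ≤ cantorCode B ω :=
  tsum_nonneg fun n => h.digit_mul_nonneg _ n

lemma cantorCode_le (h : IsCantorScale B g) (ω : ℕ → Fin 2) : cantorCode B ω ≤ B 0 := by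
  rw [← h.hasSum_sub.tsum_eq]
  exact (h.summable ω).tsum_le_tsum (fun n => h.digit_mul_le _ n) h.hasSum_sub.summable

lemma cantorCode_eq_sum_add (h : IsCantorScale B g) (ω : ℕ → Fin 2) (n : ℕ) :
    cantorCode B ω = ∑ i ∈ Finset.range n, (ω i : ℝ) * (B i - B (i + 1)) +
      cantorCode (fun i => B (i + n)) (fun i => ω (i + n)) := by
  rw [cantorCode, ← (h.summable ω).sum_add_tsum_nat_add n, cantorCode]
  congr 2
  ext i
  rw [show i + n + 1 = i + 1 + n by ring]

lemma abs_sub_le (h : IsCantorScale B g) {ω η : ℕ → Fin 2} {n : ℕ}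
    (hn : ∀ i < n, ω i = η i) : |cantorCode B ω - cantorCode B η| ≤ B n := by
  rw [h.cantorCode_eq_sum_add ω n, h.cantorCode_eq_sum_add η n]
  have hs : ∑ i ∈ Finset.range n, (ω i : ℝ) * (B i - B (i + 1)) =
      ∑ i ∈ Finset.range n, (η i : ℝ) * (B i - B (i + 1)) :=
    Finset.sum_congr rfl fun i hi => by rw [hn i (Finset.mem_range.1 hi)]
  have h1 := (h.shift n).cantorCode_nonneg fun i => ω (i + n)
  have h2 := (h.shift n).cantorCode_le fun i => ω (i + n)
  have h3 := (h.shift n).cantorCode_nonneg fun i => η (i + n)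
  have h4 := (h.shift n).cantorCode_le fun i => η (i + n)
  simp only [zero_add] at h2 h4
  rw [hs, add_sub_add_left_eq_sub, abs_le]
  constructor <;> linarith

lemma gap_le_sub (h : IsCantorScale B g) {ω η : ℕ → Fin 2} {n : ℕ}
    (hn : ∀ i < n, ω i = η i) (h0 : ω n = 0) (h1 : η n = 1) :
    g n ≤ cantorCode B η - cantorCode B ω := by
  rw [h.cantorCode_eq_sum_add ω (n + 1), h.cantorCode_eq_sum_add η (n + 1)]
  have hs : ∑ i ∈ Finset.range n, (ω i : ℝ) * (B i - B (i + 1)) =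
      ∑ i ∈ Finset.range n, (η i : ℝ) * (B i - B (i + 1)) :=
    Finset.sum_congr rfl fun i hi => by rw [hn i (Finset.mem_range.1 hi)]
  have h2 := (h.shift (n + 1)).cantorCode_le fun i => ω (i + (n + 1))
  have h3 := (h.shift (n + 1)).cantorCode_nonneg fun i => η (i + (n + 1))
  have h4 := h.gap_add_le n
  simp only [zero_add] at h2
  rw [Finset.sum_range_succ, Finset.sum_range_succ, hs, h0, h1]
  simp only [Fin.val_zero, Fin.val_one, Nat.cast_zero, Nat.cast_one]
  linarith

lemma gap_le_abs_sub (h : IsCantorScale B g) {ω η : ℕ → Fin 2} {n : ℕ}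
    (hn : ∀ i < n, ω i = η i) (hne : ω n ≠ η n) :
    g n ≤ |cantorCode B ω - cantorCode B η| := by
  have key : (ω n = 0 ∧ η n = 1) ∨ (η n = 0 ∧ ω n = 1) := by omega
  rcases key with ⟨h0, h1⟩ | ⟨h0, h1⟩
  · rw [abs_sub_comm]
    exact (h.gap_le_sub hn h0 h1).trans (le_abs_self _)
  · exact (h.gap_le_sub (fun i hi => (hn i hi).symm) h0 h1).trans (le_abs_self _)

lemma exists_first_ne {ω η : ℕ → Fin 2} (hne : ω ≠ η) :
    ∃ n, (∀ i < n, ω i = η i) ∧ ω n ≠ η n :=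
  ⟨PiNat.firstDiff ω η, fun _ hi => PiNat.apply_eq_of_lt_firstDiff hi,
    PiNat.apply_firstDiff_ne hne⟩

/-- Points of the Cantor set at distance less than the gap `g n` lie in one interval of
length `B (n + 1)`. -/
lemma abs_sub_le_of_lt_gap (h : IsCantorScale B g) {ω η : ℕ → Fin 2} {n : ℕ}
    (hlt : |cantorCode B ω - cantorCode B η| < g n) :
    |cantorCode B ω - cantorCode B η| ≤ B (n + 1) := by
  refine h.abs_sub_le fun i hi => ?_
  by_contra hne
  obtain ⟨m, hm, hm'⟩ := exists_first_ne (ω := ω) (η := η) fun e => hne (by rw [e])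
  have hmi : m ≤ i := by
    by_contra hc
    exact hne (hm i (by omega))
  -- A split at a stage m ≤ n would already force distance g m ≥ g n.
  have := h.gap_anti.antitone (show m ≤ n by omega)
  linarith [h.gap_le_abs_sub hm hm']

lemma continuous_cantorCode (h : IsCantorScale B g) : Continuous (cantorCode B) := by
  refine continuous_tsum (u := fun n => B n - B (n + 1)) (fun n => ?_) h.hasSum_sub.summable
    fun n ω => ?_
  · exact (continuous_of_discreteTopology (f := fun a : Fin 2 => (a : ℝ))).comp
      (continuous_apply n) |>.mul continuous_const
  · rw [Real.norm_of_nonneg (h.digit_mul_nonneg _ n)]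
    exact h.digit_mul_le _ n

lemma isCompact_range (h : IsCantorScale B g) : IsCompact (range (cantorCode B)) :=
  _root_.isCompact_range h.continuous_cantorCode

lemma injective_cantorCode (h : IsCantorScale B g) : Function.Injective (cantorCode B) := by
  intro ω η he
  by_contra hne
  obtain ⟨n, hn, hn'⟩ := exists_first_ne hne
  have := h.gap_le_abs_sub hn hn'
  rw [he, sub_self, abs_zero] at this
  exact absurd (h.gap_pos n) this.not_gt

/-! ### Dimension bounds for products of Cantor sets -/

/-- Covering by the products of basic intervals bounds the dimension from above. -/
lemma dimH_pi_range_le (h : IsCantorScale B g) (d : ℕ) {s : ℝ} (hs : 0 < s)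
    (hB : ∀ n, 2 ^ (n * d) * B n ^ s ≤ 1) :
    dimH (Set.pi univ fun _ : Fin d => range (cantorCode B)) ≤ ENNReal.ofReal s := by
  set E := Set.pi univ fun _ : Fin d => range (cantorCode B)
  have hmeas : μH[s] E ≤ 1 := by
    let t : ∀ n : ℕ, (Fin d → Fin n → Fin 2) → Set (Fin d → ℝ) := fun n c =>
      Set.pi univ fun j => cantorCode B '' {ω | ∀ k : Fin n, ω k = c j k}
    have hdiam : ∀ n c, Metric.ediam (t n c) ≤ ENNReal.ofReal (B n) := by
      intro n c
      refine Metric.ediam_pi_le_of_le fun j => Metric.ediam_le ?_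
      rintro _ ⟨ω, hω, rfl⟩ _ ⟨η, hη, rfl⟩
      rw [edist_dist, Real.dist_eq]
      refine ENNReal.ofReal_le_ofReal (h.abs_sub_le fun i hi => ?_)
      exact (hω ⟨i, hi⟩).trans (hη ⟨i, hi⟩).symm
    refine (Measure.hausdorffMeasure_le_liminf_sum s E (l := atTop)
      (fun n => ENNReal.ofReal (B n)) ?_ t (Eventually.of_forall hdiam)
      (Eventually.of_forall fun n => ?_)).trans ?_
    · simpa using (ENNReal.tendsto_ofReal h.tendsto_zero)
    · intro z hz
      choose ω hω using fun j => hz j (mem_univ j)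
      exact mem_iUnion.2 ⟨fun j k => ω j k, fun j _ => ⟨ω j, fun k => rfl, hω j⟩⟩
    · refine liminf_le_of_le (by isBoundedDefault) fun b hb => ?_
      obtain ⟨n, hn⟩ := hb.exists
      refine hn.trans ?_
      calc ∑ c, Metric.ediam (t n c) ^ s
          ≤ ∑ _c : Fin d → Fin n → Fin 2, ENNReal.ofReal (B n) ^ s :=
            Finset.sum_le_sum fun c _ => ENNReal.rpow_le_rpow (hdiam n c) hs.le
        _ = ENNReal.ofReal (2 ^ (n * d) * B n ^ s) := by
            rw [Finset.sum_const, Finset.card_univ, nsmul_eq_mul,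
              ENNReal.ofReal_rpow_of_nonneg (h.nonneg n) hs.le,
              ENNReal.ofReal_mul (by positivity)]
            congr 1
            simp [pow_mul, ENNReal.ofReal_pow]
        _ ≤ 1 := by simpa using ENNReal.ofReal_le_ofReal (hB n)
  have : μH[((⟨s, hs.le⟩ : NNReal) : ℝ)] E ≠ ⊤ := ne_top_of_le_ne_top ENNReal.one_ne_top hmeas
  rw [ENNReal.ofReal, Real.toNNReal_of_nonneg hs.le]
  exact dimH_le_of_hausdorffMeasure_ne_top this

/-- If the gaps decay slowly enough, then reading binary digits is a Hölder map from the product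
Cantor set onto the unit cube, which bounds the dimension from below. -/
lemma le_dimH_pi_range (h : IsCantorScale B g) (d : ℕ) {γ K : NNReal} (hγ : 0 < γ)
    (hK : ∀ n, (2 ^ n : ℝ)⁻¹ ≤ K * g n ^ (γ : ℝ)) :
    γ * d ≤ dimH (Set.pi univ fun _ : Fin d => range (cantorCode B)) := by
  set E := Set.pi univ fun _ : Fin d => range (cantorCode B)
  -- Off the Cantor set the value of `ψ` is arbitrary; only points of `E` matter.
  let ψ : ℝ → ℝ := fun r => Real.ofDigits (Function.invFun (cantorCode B) r)
  have hψ : ∀ ω, ψ (cantorCode B ω) = Real.ofDigits ω := fun ω => by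
    simp only [ψ, Function.leftInverse_invFun h.injective_cantorCode ω]
  have hHolder : ∀ ω η, |Real.ofDigits ω - Real.ofDigits η| ≤
      K * |cantorCode B ω - cantorCode B η| ^ (γ : ℝ) := by
    intro ω η
    by_cases hne : ω = η
    · subst hne
      simp [Real.zero_rpow (NNReal.coe_pos.2 hγ).ne']
    obtain ⟨n, hn, hn'⟩ := exists_first_ne hne
    refine (Real.abs_ofDigits_sub_ofDigits_le hn).trans ?_
    refine (by simpa using hK n : _ ≤ K * g n ^ (γ : ℝ)).trans ?_
    gcongr
    · exact (h.gap_pos n).le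
    · exact h.gap_le_abs_sub hn hn'
  have hf : HolderOnWith K γ (fun (z : Fin d → ℝ) i => ψ (z i)) E := by
    intro z hz w hw
    refine edist_pi_le_iff.2 fun i => ?_
    obtain ⟨ω, hω⟩ := hz i (mem_univ i)
    obtain ⟨η, hη⟩ := hw i (mem_univ i)
    calc edist (ψ (z i)) (ψ (w i)) ≤ K * edist (z i) (w i) ^ (γ : ℝ) := by
          rw [← hω, ← hη, hψ, hψ, edist_dist, edist_dist, Real.dist_eq, Real.dist_eq,
            ENNReal.ofReal_rpow_of_nonneg (abs_nonneg _) γ.coe_nonneg, ← ENNReal.ofReal_coe_nnreal,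
            ← ENNReal.ofReal_mul K.coe_nonneg]
          exact ENNReal.ofReal_le_ofReal (hHolder ω η)
      _ ≤ _ := by
          gcongr
          exact edist_le_pi_edist z w i
  have hsub : (Set.pi univ fun _ : Fin d => Icc (0 : ℝ) 1) ⊆
      (fun (z : Fin d → ℝ) i => ψ (z i)) '' E := by
    intro y hy
    choose ω _ hω using fun i => Real.ofDigits_SurjOn one_lt_two (hy i (mem_univ i))
    exact ⟨fun i => cantorCode B (ω i), fun i _ => mem_range_self _,
      funext fun i => (hψ _).trans (hω i)⟩
  have hcube : dimH (Set.pi univ fun _ : Fin d => Icc (0 : ℝ) 1) = d := by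
    rw [Real.dimH_of_mem_nhds (x := fun _ => 1 / 2)]
    · simp
    · exact set_pi_mem_nhds finite_univ fun i _ => Icc_mem_nhds (by norm_num) (by norm_num)
  have := (dimH_mono hsub).trans (hf.dimH_image_le hγ)
  rw [hcube, ENNReal.le_div_iff_mul_le (Or.inl (by simpa using hγ.ne')) (Or.inl (by simp))]
    at this
  rwa [mul_comm]

end IsCantorScale

/-! ### Tangent sets of Cantor products -/

/-- The `d`-fold product of a Cantor set, as a subset of Euclidean space. -/
def cantorPower (d : ℕ) (B : ℕ → ℝ) : Set (EuclideanSpace ℝ (Fin d)) :=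
  EuclideanSpace.equiv (Fin d) ℝ ⁻¹' Set.pi univ fun _ => range (cantorCode B)

/-- Passing to the sup metric preserves dimension and makes diameters and Hölder bounds
coordinatewise. -/
lemma dimH_cantorPower (d : ℕ) (B : ℕ → ℝ) :
    dimH (cantorPower d B) = dimH (Set.pi univ fun _ : Fin d => range (cantorCode B)) :=
  (EuclideanSpace.equiv (Fin d) ℝ).dimH_preimage _

lemma mem_cantorPower {d : ℕ} {B : ℕ → ℝ} {y : EuclideanSpace ℝ (Fin d)} :
    y ∈ cantorPower d B ↔ ∀ i, y i ∈ range (cantorCode B) := by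
  simp [cantorPower, Set.mem_pi]

lemma singleton_zero_mem_compactsQ (d : ℕ) :
    ({0} : Set (EuclideanSpace ℝ (Fin d))) ∈ compactsQ d := by
  refine ⟨isCompact_singleton, singleton_nonempty _, ?_⟩
  rintro _ rfl i
  simp

lemma zero_mem_zoom {d : ℕ} {E : Set (EuclideanSpace ℝ (Fin d))} {x : EuclideanSpace ℝ (Fin d)}
    (hx : x ∈ E) (t : ℝ) : 0 ∈ zoom x t E := by
  refine ⟨⟨x, hx, by simp⟩, fun i => ?_⟩
  simp

lemma EuclideanSpace.norm_le_card_mul {d : ℕ} {y : EuclideanSpace ℝ (Fin d)} {r : ℝ}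
    (h : ∀ i, |y i| ≤ r) : ‖y‖ ≤ d * r := by
  calc ‖y‖ = ‖∑ i, EuclideanSpace.single i (y i)‖ := by
        congr 1
        ext j
        simp [Finset.sum_apply, Pi.single_apply]
    _ ≤ ∑ i, ‖EuclideanSpace.single i (y i)‖ := norm_sum_le _ _
    _ ≤ ∑ _i : Fin d, r := Finset.sum_le_sum fun i _ => by simpa using h i
    _ = d * r := by simp

namespace IsCantorScale

variable {B g : ℕ → ℝ}

lemma cantorPower_mem_compactsQ (h : IsCantorScale B g) (h0 : B 0 ≤ 1) (d : ℕ) :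
    cantorPower d B ∈ compactsQ d := by
  refine ⟨?_, ?_, ?_⟩
  · exact (EuclideanSpace.equiv (Fin d) ℝ).toHomeomorph.isCompact_preimage.2
      (isCompact_univ_pi fun _ => h.isCompact_range)
  · exact ⟨(EuclideanSpace.equiv (Fin d) ℝ).symm fun _ => cantorCode B 0,
      mem_cantorPower.2 fun i => ⟨0, rfl⟩⟩
  · intro y hy i
    obtain ⟨ω, hω⟩ := mem_cantorPower.1 hy i
    rw [← hω]
    constructor <;> linarith [h.cantorCode_nonneg ω, h.cantorCode_le ω]

lemma norm_le_of_mem_zoom (h : IsCantorScale B g) {d : ℕ} {x z : EuclideanSpace ℝ (Fin d)}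
    (hx : x ∈ cantorPower d B) (n : ℕ) (hz : z ∈ zoom x (g n / 2) (cantorPower d B)) :
    ‖z‖ ≤ d * (2 * (B (n + 1) / g n)) := by
  obtain ⟨⟨y, hy, rfl⟩, hQ⟩ := hz
  refine EuclideanSpace.norm_le_card_mul fun i => ?_
  obtain ⟨ω, hω⟩ := mem_cantorPower.1 hy i
  obtain ⟨η, hη⟩ := mem_cantorPower.1 hx i
  have hg := h.gap_pos n
  have hle : |(g n / 2)⁻¹ * (y i - x i)| ≤ 1 := abs_le.2 (hQ i)
  have hEq : |(g n / 2)⁻¹ * (y i - x i)| = 2 * (|y i - x i| / g n) := by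
    rw [abs_mul, abs_of_pos (by positivity)]
    field_simp
  -- `Q` is closed, so the zoom radius is half the gap to make this strict.
  have hlt : |y i - x i| < g n := by
    rw [hEq] at hle
    have : |y i - x i| / g n < 1 := by linarith
    rwa [div_lt_one hg] at this
  change |(g n / 2)⁻¹ * (y i - x i)| ≤ _
  rw [hEq]
  rw [← hω, ← hη] at hlt ⊢
  have := h.abs_sub_le_of_lt_gap hlt
  gcongr

lemma singleton_zero_mem_Tan (h : IsCantorScale B g) {u : ℕ → ℕ} (hu : StrictMono u)
    (hlim : Tendsto (fun k => B (u k + 1) / g (u k)) atTop (𝓝 0)) {d : ℕ}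
    {x : EuclideanSpace ℝ (Fin d)} (hx : x ∈ cantorPower d B) :
    {0} ∈ Tan (cantorPower d B) x := by
  have hg : Tendsto g atTop (𝓝 0) :=
    squeeze_zero (fun n => (h.gap_pos n).le) h.gap_le h.tendsto_zero
  refine ⟨singleton_zero_mem_compactsQ d, fun k => g (u k) / 2,
    fun k => half_pos (h.gap_pos _), fun a b hab => ?_, ?_, ?_⟩
  · have := h.gap_anti (hu hab)
    simp only
    linarith
  · simpa using (hg.comp hu.tendsto_atTop).div_const 2
  · have hlim' : Tendsto (fun k => ENNReal.ofReal (d * (2 * (B (u k + 1) / g (u k)))))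
        atTop (𝓝 0) := by
      simpa using ENNReal.tendsto_ofReal ((hlim.const_mul 2).const_mul (d : ℝ))
    refine tendsto_of_tendsto_of_tendsto_of_le_of_le tendsto_const_nhds hlim'
      (fun _ => zero_le) fun k => Metric.hausdorffEDist_le_of_mem_edist ?_ ?_
    · intro z hz
      refine ⟨0, rfl, ?_⟩
      rw [edist_dist, dist_zero_right]
      exact ENNReal.ofReal_le_ofReal (h.norm_le_of_mem_zoom hx _ hz)
    · rintro _ rfl
      exact ⟨0, zero_mem_zoom hx _, by simp⟩

end IsCantorScale

/-! ### Scales with rare strong contractions -/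

/-- A slowly varying integer sequence with `jumpFactor j ≤ j ^ 4`, that is constant except for
increases from `j ^ 2` to `j ^ 4` at the numbers `j = 2 ^ 2 ^ k`. -/
def jumpFactor (j : ℕ) : ℕ := (2 ^ 2 ^ Nat.log 2 (Nat.log 2 j)) ^ 4

lemma jumpFactor_pos (j : ℕ) : 0 < jumpFactor j := by
  unfold jumpFactor
  positivity

lemma jumpFactor_mono : Monotone jumpFactor := by
  intro a b hab
  unfold jumpFactor
  gcongr
  · norm_num
  · norm_num

lemma jumpFactor_le {j : ℕ} (hj : 2 ≤ j) : jumpFactor j ≤ j ^ 4 := by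
  have h1 : Nat.log 2 j ≠ 0 := (Nat.log_pos one_lt_two hj).ne'
  have : 2 ^ 2 ^ Nat.log 2 (Nat.log 2 j) ≤ j :=
    (Nat.pow_le_pow_right two_pos (Nat.pow_log_le_self 2 h1)).trans
      (Nat.pow_log_le_self 2 (by omega))
  exact Nat.pow_le_pow_left this 4

lemma jumpFactor_two_pow (k : ℕ) : jumpFactor (2 ^ 2 ^ k) = (2 ^ 2 ^ k) ^ 4 := by
  rw [jumpFactor, Nat.log_pow one_lt_two, Nat.log_pow one_lt_two]

lemma jumpFactor_two_pow_sub_one (k : ℕ) :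
    jumpFactor (2 ^ 2 ^ (k + 1) - 1) = (2 ^ 2 ^ (k + 1)) ^ 2 := by
  have h1 : 2 ^ k < 2 ^ (k + 1) := Nat.pow_lt_pow_right one_lt_two (Nat.lt_succ_self k)
  have hk : 0 < 2 ^ k := by positivity
  have h2 : Nat.log 2 (2 ^ 2 ^ (k + 1) - 1) = 2 ^ (k + 1) - 1 := by
    obtain ⟨m, hm⟩ : ∃ m, 2 ^ (k + 1) = m + 1 := ⟨2 ^ (k + 1) - 1, by omega⟩
    rw [hm, Nat.add_sub_cancel]
    have : 0 < 2 ^ m := by positivity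
    refine Nat.log_eq_of_pow_le_of_lt_pow ?_ ?_ <;> rw [pow_succ] <;> omega
  have h3 : Nat.log 2 (2 ^ (k + 1) - 1) = k := by
    refine Nat.log_eq_of_pow_le_of_lt_pow ?_ ?_ <;> omega
  rw [jumpFactor, h2, h3, ← pow_mul, ← pow_mul, pow_succ]
  congr 1
  ring

/-- Interval lengths of a Cantor set with rare drastic contractions. -/
noncomputable def cantorLength (ρ : ℝ) (n : ℕ) : ℝ := ρ ^ n / ((n + 1) * jumpFactor (n + 1))

/-- Lower bounds for the gaps that belong to `cantorLength`. -/
noncomputable def cantorGap (ρ : ℝ) (n : ℕ) : ℝ :=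
  ρ ^ n / ((n + 1) * (n + 2) * jumpFactor (n + 1))

lemma cantorLength_le {ρ : ℝ} (h0 : 0 < ρ) (n : ℕ) : cantorLength ρ n ≤ ρ ^ n := by
  refine div_le_self (by positivity) ?_
  have h1 : (1 : ℝ) ≤ jumpFactor (n + 1) := by exact_mod_cast jumpFactor_pos (n + 1)
  have h2 : (1 : ℝ) ≤ (n : ℝ) + 1 := by linarith [(Nat.cast_nonneg n : (0 : ℝ) ≤ n)]
  exact one_le_mul_of_one_le_of_one_le h2 h1

lemma isCantorScale_cantorLength {ρ : ℝ} (h0 : 0 < ρ) (h1 : ρ ≤ 1 / 2) :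
    IsCantorScale (cantorLength ρ) (cantorGap ρ) where
  gap_pos n := by
    have : (0 : ℝ) < jumpFactor (n + 1) := by exact_mod_cast jumpFactor_pos (n + 1)
    unfold cantorGap
    positivity
  gap_anti := by
    refine strictAnti_nat_of_succ_lt fun n => ?_
    have hp : (0 : ℝ) < jumpFactor (n + 1) := by exact_mod_cast jumpFactor_pos (n + 1)
    have hm : (jumpFactor (n + 1) : ℝ) ≤ jumpFactor (n + 1 + 1) := by
      exact_mod_cast jumpFactor_mono (Nat.le_succ _)
    unfold cantorGap
    push_cast
    refine div_lt_div₀ (pow_lt_pow_right_of_lt_one₀ h0 (by linarith) n.lt_succ_self) ?_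
      (by positivity) (by positivity)
    gcongr <;> linarith
  gap_add_le n := by
    have hp : (0 : ℝ) < jumpFactor (n + 1) := by exact_mod_cast jumpFactor_pos (n + 1)
    have hm : (jumpFactor (n + 1) : ℝ) ≤ jumpFactor (n + 1 + 1) := by
      exact_mod_cast jumpFactor_mono (Nat.le_succ _)
    have key : 2 * cantorLength ρ (n + 1) ≤ ρ ^ n / ((n + 2) * jumpFactor (n + 1)) := by
      unfold cantorLength
      push_cast
      rw [← mul_div_assoc]
      refine div_le_div₀ (by positivity) ?_ (by positivity) ?_
      · rw [pow_succ]
        nlinarith [pow_pos h0 n]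
      · exact mul_le_mul (by linarith) hm hp.le (by positivity)
    -- This is 1/((n+1)(n+2)) = 1/(n+1) - 1/(n+2): the factor n+1 leaves room for gaps even when ρ =
    -- 1/2.
    have : cantorGap ρ n + ρ ^ n / ((n + 2) * jumpFactor (n + 1)) = cantorLength ρ n := by
      unfold cantorGap cantorLength
      field_simp
      ring
    linarith
  nonneg n := by
    unfold cantorLength
    positivity
  tendsto_zero :=
    squeeze_zero (fun n => by unfold cantorLength; positivity) (cantorLength_le h0)
      (tendsto_pow_atTop_nhds_zero_of_lt_one h0.le (by linarith))

/-- The ratio is ρ (n+1) J(n+1) / J(n+2) with J = `jumpFactor`. At n + 2 = N = 2 ^ 2 ^ (k+1) the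
jump from N ^ 2 to N ^ 4 makes it at most 1/N. -/
lemma tendsto_cantorLength_div_cantorGap {ρ : ℝ} (h0 : 0 < ρ) (h1 : ρ ≤ 1) :
    Tendsto (fun k => cantorLength ρ (2 ^ 2 ^ (k + 1) - 2 + 1) / cantorGap ρ (2 ^ 2 ^ (k + 1) - 2))
      atTop (𝓝 0) := by
  have hN : Tendsto (fun k : ℕ => (2 : ℕ) ^ 2 ^ (k + 1)) atTop atTop :=
    (tendsto_pow_atTop_atTop_of_one_lt one_lt_two).comp
      ((tendsto_pow_atTop_atTop_of_one_lt one_lt_two).comp (tendsto_add_atTop_nat 1))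
  have hlim : Tendsto (fun k : ℕ => (((2 : ℕ) ^ 2 ^ (k + 1) : ℕ) : ℝ)⁻¹) atTop (𝓝 0) :=
    tendsto_inv_atTop_zero.comp (tendsto_natCast_atTop_atTop.comp hN)
  refine squeeze_zero (fun k => by unfold cantorLength cantorGap; positivity) (fun k => ?_) hlim
  have hJ := jumpFactor_two_pow (k + 1)
  have hJ' := jumpFactor_two_pow_sub_one k
  have h2 : 2 ≤ 2 ^ 2 ^ (k + 1) := Nat.le_self_pow (by positivity) 2
  generalize 2 ^ 2 ^ (k + 1) = N at *
  obtain ⟨n, rfl⟩ : ∃ n, N = n + 2 := ⟨N - 2, by omega⟩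
  rw [show n + 2 - 1 = n + 1 by omega] at hJ'
  rw [Nat.add_sub_cancel]
  unfold cantorLength cantorGap
  rw [show n + 1 + 1 = n + 2 by ring, hJ, hJ']
  push_cast
  have hn : (0 : ℝ) ≤ n := Nat.cast_nonneg n
  have : ρ ^ (n + 1) / (((n : ℝ) + 1 + 1) * ((n + 2) ^ 4)) /
      (ρ ^ n / ((n + 1) * (n + 2) * (n + 2) ^ 2)) = ρ * ((n + 1) / (n + 2) ^ 2) := by
    rw [pow_succ, show (n : ℝ) + 1 + 1 = n + 2 by ring]
    field_simp
  rw [this]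
  calc ρ * (((n : ℝ) + 1) / (n + 2) ^ 2) ≤ 1 * (((n : ℝ) + 2) / (n + 2) ^ 2) := by
        gcongr
        norm_num
    _ = ((n : ℝ) + 2)⁻¹ := by field_simp

lemma le_cantorGap {ρ : ℝ} (h0 : 0 < ρ) (n : ℕ) : ρ ^ n / ((n : ℝ) + 2) ^ 6 ≤ cantorGap ρ n := by
  have hp : (0 : ℝ) < jumpFactor (n + 1) := by exact_mod_cast jumpFactor_pos (n + 1)
  have hj : (jumpFactor (n + 1) : ℝ) ≤ ((n : ℝ) + 2) ^ 4 := by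
    exact_mod_cast (jumpFactor_mono (Nat.le_succ (n + 1))).trans (jumpFactor_le (by omega))
  unfold cantorGap
  refine div_le_div_of_nonneg_left (by positivity) (by positivity) ?_
  calc ((n : ℝ) + 1) * (n + 2) * jumpFactor (n + 1)
      ≤ (n + 2) * (n + 2) * (n + 2) ^ 4 := by gcongr; norm_num
    _ = _ := by ring

/-- The gaps `cantorGap ρ n` exceed `2 ^ (-n / γ)` up to a constant, if `2 * ρ ^ γ > 1`. -/
lemma exists_le_mul_cantorGap_rpow {ρ γ : ℝ} (h0 : 0 < ρ) (hγ : 0 < γ) (hγ1 : γ ≤ 1)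
    (hργ : 1 < 2 * ρ ^ γ) :
    ∃ K : NNReal, ∀ n, (2 ^ n : ℝ)⁻¹ ≤ K * cantorGap ρ n ^ γ := by
  have hργ0 : 0 < ρ ^ γ := Real.rpow_pos_of_pos h0 γ
  set q := (2 * ρ ^ γ)⁻¹ with hq
  have hq0 : 0 < q := by positivity
  have hq1 : q < 1 := inv_lt_one_of_one_lt₀ hργ
  -- The polynomial loss (n+2) ^ 6 is beaten by the geometric decay of q ^ n; the shift by 2 costs
  -- the factor q ^ 2.
  have hlim := (tendsto_add_atTop_iff_nat 2).2
    (tendsto_pow_const_mul_const_pow_of_abs_lt_one 6 (by rwa [abs_of_pos hq0]))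
  obtain ⟨C, hC⟩ := hlim.bddAbove_range
  refine ⟨(C / q ^ 2).toNNReal, fun n => ?_⟩
  have hCn : ((n : ℝ) + 2) ^ 6 * q ^ n ≤ C / q ^ 2 := by
    rw [le_div_iff₀ (by positivity)]
    have := hC ⟨n, rfl⟩
    simp only [Nat.cast_add, Nat.cast_ofNat, pow_add] at this
    linarith
  have hpow : ((n : ℝ) + 2) ^ 6 ≥ (((n : ℝ) + 2) ^ 6) ^ γ := by
    have h1 : (1 : ℝ) ≤ ((n : ℝ) + 2) ^ 6 :=
      one_le_pow₀ (by linarith [(Nat.cast_nonneg n : (0 : ℝ) ≤ n)])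
    simpa using Real.rpow_le_rpow_of_exponent_le h1 hγ1
  have hgap : (ρ ^ γ) ^ n / ((n : ℝ) + 2) ^ 6 ≤ cantorGap ρ n ^ γ := by
    calc (ρ ^ γ) ^ n / ((n : ℝ) + 2) ^ 6 ≤ (ρ ^ γ) ^ n / (((n : ℝ) + 2) ^ 6) ^ γ := by
          gcongr
      _ = (ρ ^ n / ((n : ℝ) + 2) ^ 6) ^ γ := by
          rw [Real.div_rpow (by positivity) (by positivity), ← Real.rpow_natCast,
            ← Real.rpow_mul h0.le, mul_comm, Real.rpow_mul h0.le, Real.rpow_natCast]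
      _ ≤ _ := Real.rpow_le_rpow (by positivity) (le_cantorGap h0 n) hγ.le
  calc (2 ^ n : ℝ)⁻¹ = (((n : ℝ) + 2) ^ 6 * q ^ n) * ((ρ ^ γ) ^ n / ((n : ℝ) + 2) ^ 6) := by
        rw [hq, inv_pow, mul_pow]
        field_simp
    _ ≤ (C / q ^ 2).toNNReal * cantorGap ρ n ^ γ := by
        gcongr
        exact hCn.trans (Real.le_coe_toNNReal _)

lemma dimH_cantorPower_cantorLength {d : ℕ} {s : ℝ} (hs : 0 < s) (hsd : s ≤ d) :
    dimH (cantorPower d (cantorLength (2 ^ (-(d / s))))) = ENNReal.ofReal s := by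
  have hd : (0 : ℝ) < d := hs.trans_le hsd
  set ρ : ℝ := 2 ^ (-(d / s)) with hρ
  have h0 : 0 < ρ := by positivity
  have h1 : ρ ≤ 1 / 2 := by
    rw [hρ, one_div, ← Real.rpow_neg_one]
    refine Real.rpow_le_rpow_of_exponent_le one_le_two ?_
    rw [neg_le_neg_iff, one_le_div hs]
    exact hsd
  have h := isCantorScale_cantorLength h0 h1
  rw [dimH_cantorPower]
  refine le_antisymm (h.dimH_pi_range_le d hs fun n => ?_) ?_
  · calc (2 : ℝ) ^ (n * d) * cantorLength ρ n ^ s ≤ 2 ^ (n * d) * (ρ ^ n) ^ s := by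
          gcongr
          · exact h.nonneg n
          · exact cantorLength_le h0 n
      _ = 1 := by
          rw [hρ, ← Real.rpow_natCast, ← Real.rpow_natCast, ← Real.rpow_mul zero_le_two,
            ← Real.rpow_mul zero_le_two, ← Real.rpow_add two_pos]
          convert Real.rpow_zero 2
          push_cast
          field_simp
          ring
  -- For r < s, the exponent γ = r/d gives 2 ρ ^ γ = 2 ^ (1 - r/s) > 1, the slack that absorbs the
  -- polynomial factors.
  · refine ENNReal.le_of_forall_nnreal_lt fun r hr => ?_
    rcases eq_or_ne r 0 with rfl | hr0
    · simp
    have hrs : (r : ℝ) < s := by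
      rw [ENNReal.ofReal, ENNReal.coe_lt_coe] at hr
      exact (Real.lt_toNNReal_iff_coe_lt).1 hr
    have hrpos : (0 : ℝ) < r := NNReal.coe_pos.2 (pos_iff_ne_zero.2 hr0)
    have hdN : (d : NNReal) ≠ 0 := by exact_mod_cast hd.ne'
    have hγ : (0 : ℝ) < (r / d : NNReal) := by
      push_cast
      positivity
    obtain ⟨K, hK⟩ := exists_le_mul_cantorGap_rpow h0 hγ
      (by push_cast; rw [div_le_one hd]; linarith) (by
        have hexp : -((d : ℝ) / s) * (r / d : NNReal) = -(r / s) := by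
          push_cast
          field_simp
        have hlt : 0 < 1 + -(r / s) := by linarith [(div_lt_one hs).2 hrs]
        rw [hρ, ← Real.rpow_mul zero_le_two, hexp,
          ← Real.rpow_one_add' zero_le_two hlt.ne']
        exact Real.one_lt_rpow one_lt_two hlt)
    have := h.le_dimH_pi_range d (NNReal.coe_pos.1 hγ) hK
    refine le_trans (le_of_eq ?_) this
    rw [← ENNReal.coe_natCast, ← ENNReal.coe_mul, div_mul_cancel₀ _ hdN]

theorem theorem5p3 (d : ℕ) (s : ℝ) (hs : s ∈ Set.Icc (0 : ℝ) (d : ℝ)) :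
    ∃ E : Set (EuclideanSpace ℝ (Fin d)), E ∈ compactsQ d ∧
      dimH E = ENNReal.ofReal s ∧
      ∀ x ∈ E, ({0} : Set (EuclideanSpace ℝ (Fin d))) ∈ Tan E x := by
  -- The exponent d/s requires s > 0; for s = 0 a single point suffices.
  rcases hs.1.eq_or_lt with rfl | hpos
  · refine ⟨{0}, singleton_zero_mem_compactsQ d, by simp, ?_⟩
    rintro _ rfl
    refine ⟨singleton_zero_mem_compactsQ d, fun n => 1 / ((n : ℝ) + 1), fun n => by positivity,
      fun a b hab => ?_, tendsto_one_div_add_atTop_nhds_zero_nat, ?_⟩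
    · have : (a : ℝ) < b := by exact_mod_cast hab
      exact one_div_lt_one_div_of_lt (by positivity) (by linarith)
    · have : ∀ t : ℝ, zoom 0 t {(0 : EuclideanSpace ℝ (Fin d))} = {0} := fun t => by
        refine Subset.antisymm ?_ (singleton_subset_iff.2 (zero_mem_zoom (mem_singleton _) t))
        rintro _ ⟨⟨y, rfl, rfl⟩, -⟩
        simp
      simp [this]
  · have hρ : (2 : ℝ) ^ (-((d : ℝ) / s)) ≤ 1 / 2 := by
      rw [one_div, ← Real.rpow_neg_one]
      refine Real.rpow_le_rpow_of_exponent_le one_le_two ?_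
      rw [neg_le_neg_iff, one_le_div hpos]
      exact hs.2
    have hρ0 : (0 : ℝ) < 2 ^ (-((d : ℝ) / s)) := by positivity
    have h := isCantorScale_cantorLength hρ0 hρ
    refine ⟨cantorPower d (cantorLength (2 ^ (-((d : ℝ) / s)))),
      h.cantorPower_mem_compactsQ (by simpa using cantorLength_le hρ0 0) d,
      dimH_cantorPower_cantorLength hpos hs.2, fun x hx => ?_⟩
    refine h.singleton_zero_mem_Tan (u := fun k => 2 ^ 2 ^ (k + 1) - 2) (fun a b hab => ?_)
      (tendsto_cantorLength_div_cantorGap hρ0 (by linarith)) hx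
    have h1 : 2 ^ 2 ^ (a + 1) < 2 ^ 2 ^ (b + 1) :=
      Nat.pow_lt_pow_right one_lt_two (Nat.pow_lt_pow_right one_lt_two (by omega))
    have h2 : 2 ≤ 2 ^ 2 ^ (a + 1) := Nat.le_self_pow (by positivity) 2
    simp only
    omega
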